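/- Let $K$ be the number of arms, $T$ the number of epochs, $s_a>0$ ($1\le a\le K$) the measurement standard deviations, $b_t>0$ ($0\le t<T$) the batch-size constants, $h\in\mathbb R^K$ a fixed vector of (scaled) average rewards, and $(\mu_0,\sigma_0)\in\mathbb R^K\times(0,\infty)^K$ a fixed prior. Let $\pi_t:\mathbb R^K\times(0,\infty)^K\to\Delta_K$ ($0\le t<T$) be continuous maps into the probability simplex (a policy continuous in the posterior state). Given observations $r_0,r_1,\ldots\in\mathbb R^K$, define posterior states recursively from $(\mu_0,\sigma_0)$ by $$\sigma_{t+1,a}^{-2}=\sigma_{t,a}^{-2}+s_a^{-2}b_t\,\pi_{t,a}(\mu_t,\sigma_t),\qquad \mu_{t+1,a}=\sigma_{t+1,a}^{2}\left(\sigma_{t,a}^{-2}\mu_{t,a}+s_a^{-2}b_t\,r_{t,a}\right).$$ *Pre-limit experiment.* For each scaling $n\in\mathbb N$, epoch $t$ has $\lfloor b_tn\rfloor$ units. If unit $j$ of epoch $t$ is assigned to arm $a$ (written $\xi^t_{a,j}=1$; each unit is assigned to exactly one arm), its reward is $R^t_{a,j}=h_a/\sqrt n+\epsilon^t_{a,j}$.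 Put $\sqrt n\,\bar R^n_{t,a}=\frac1{b_t\sqrt n}\sum_{j=1}^{\lfloor b_tn\rfloor}\xi^t_{a,j}R^t_{a,j}$, and let $(\mu_{n,t},\sigma_{n,t})$ be the posterior states computed from $r_t=\sqrt n\,\bar R^n_t$. Conditionally on $\bar R^n_0,\ldots,\bar R^n_{t-1}$, the units of epoch $t$ are i.i.d., each is assigned to an arm drawn from $\pi_t(\mu_{n,t},\sigma_{n,t})$, its noise vector $\epsilon^t_j=(\epsilon^t_{a,j})_a$ has a fixed law, and its assignment is independent of its noise vector. The noise law does not depend on $n$, $t$, $j$ and satisfies $\mathbb E\epsilon_a=0$, $\mathrm{Var}(\epsilon_a)=s_a^2$ and $\mathbb E\|\epsilon\|_2^4<\infty$. *Limit experiment.* Let $G_0,\ldots,G_{T-1}$ be the Gaussian sequential experiment with the same $h$: with $(\mu_t,\sigma_t)$ the posterior states computed from $r_t=G_t$, the conditional law of $G_t$ given $G_0,\ldots,G_{t-1}$ is $N\big((p_ah_a)_a,\ \mathrm{diag}(p_as_a^2/b_t)_a\big)$, where $p=\pi_t(\mu_t,\sigma_t)$. Then, as $n\to\infty$, jointly over epochs,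 $$(\mu_{n,0},\sigma_{n,0},\ldots,\mu_{n,T-1},\sigma_{n,T-1})\ \xrightarrow{d}\ (\mu_0,\sigma_0,\ldots,\mu_{T-1},\sigma_{T-1}).$$ -/

import Mathlib

open MeasureTheory ProbabilityTheory Filter

namespace BatchedExperiment

noncomputable section

/-- The positive reals, with the topology and the Borel σ-algebra inherited from `ℝ`. -/
abbrev PosReal : Type := {x : ℝ // 0 < x}

/-- Posterior states `(μ, σ)` of `K` arms: a vector of means and a vector of (positive) standard
deviations. -/
abbrev State (K : ℕ) : Type := (Fin K → ℝ) × (Fin K → PosReal)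

/-- A policy that depends continuously on the posterior state: in epoch `t` it maps a state to an
allocation, i.e. a point of the probability simplex over the `K` arms. -/
abbrev ContinuousPolicy (K : ℕ) : Type := ℕ → C(State K, stdSimplex ℝ (Fin K))

variable {K : ℕ}

/-! ### Posterior updates -/

/-- The updated posterior standard deviation `σ'`, i.e. `σ'⁻² = σ⁻² + s⁻² β p`, for measurement
standard deviation `s`, batch-size constant `β` and sampling probability `p`. -/
def nextSd (s β σ : PosReal) (p : ℝ) (hp : 0 ≤ p) : PosReal :=
  ⟨(√(((σ : ℝ) ^ 2)⁻¹ + ((s : ℝ) ^ 2)⁻¹ * β * p))⁻¹, by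
    have h1 := σ.2
    have h2 := s.2
    have h3 := β.2
    positivity⟩

/-- The defining relation of the posterior variance. -/
theorem nextSd_spec (s β σ : PosReal) (p : ℝ) (hp : 0 ≤ p) :
    ((nextSd s β σ p hp : ℝ) ^ 2)⁻¹ = ((σ : ℝ) ^ 2)⁻¹ + ((s : ℝ) ^ 2)⁻¹ * β * p := by
  have h1 := σ.2
  have h2 := s.2
  have h3 := β.2
  simp only [nextSd, inv_pow, inv_inv]
  exact Real.sq_sqrt (by positivity)

/-- One posterior update from the state `x = (μ, σ)` after a batch with allocation `p` and
(scaled) aggregate observation `g`: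
`σ'ₐ⁻² = σₐ⁻² + sₐ⁻² β pₐ` and `μ'ₐ = σ'ₐ² (σₐ⁻² μₐ + sₐ⁻² β gₐ)`. -/
def update (s : Fin K → PosReal) (β : PosReal) (p : stdSimplex ℝ (Fin K)) (x : State K)
    (g : Fin K → ℝ) : State K :=
  (fun a => (nextSd (s a) β (x.2 a) (p.1 a) (p.2.1 a) : ℝ) ^ 2 *
      (((x.2 a : ℝ) ^ 2)⁻¹ * x.1 a + ((s a : ℝ) ^ 2)⁻¹ * β * g a),
    fun a => nextSd (s a) β (x.2 a) (p.1 a) (p.2.1 a))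

/-- The posterior state at the beginning of epoch `t`, as a function of the observations
`r 0, …, r (t - 1)`, when the prior is `x₀ = (μ₀, σ₀)` and the allocations are
`π 0, …, π (t - 1)` evaluated at the current posterior states. -/
def posterior (s : Fin K → PosReal) (b : ℕ → PosReal) (π : ContinuousPolicy K) (x₀ : State K) :
    (t : ℕ) → (Fin t → Fin K → ℝ) → State K
  | 0, _ => x₀
  | t + 1, r =>
      let x := posterior s b π x₀ t (Fin.init r)
      update s (b t) (π t x) x (r (Fin.last t))

theorem continuous_posterior (s : Fin K → PosReal) (b : ℕ → PosReal) (π : ContinuousPolicy K)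
    (x₀ : State K) (t : ℕ) : Continuous (posterior s b π x₀ t) := by
  induction t with
  | zero => exact continuous_const
  | succ t ih =>
    have hx : Continuous fun r : Fin (t + 1) → Fin K → ℝ => posterior s b π x₀ t (Fin.init r) :=
      ih.comp (continuous_pi fun i => continuous_apply i.castSucc)
    have hp : Continuous fun r : Fin (t + 1) → Fin K → ℝ =>
        π t (posterior s b π x₀ t (Fin.init r)) := (π t).continuous.comp hx
    have hσ : ∀ a, Continuous fun r : Fin (t + 1) → Fin K → ℝ =>
        ((posterior s b π x₀ t (Fin.init r)).2 a : ℝ) := fun a =>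
      continuous_subtype_val.comp ((continuous_apply a).comp (continuous_snd.comp hx))
    have hpa : ∀ a, Continuous fun r : Fin (t + 1) → Fin K → ℝ =>
        (π t (posterior s b π x₀ t (Fin.init r))).1 a := fun a =>
      (continuous_apply a).comp (continuous_subtype_val.comp hp)
    have hnext : ∀ a, Continuous fun r : Fin (t + 1) → Fin K → ℝ =>
        nextSd (s a) (b t) ((posterior s b π x₀ t (Fin.init r)).2 a)
          ((π t (posterior s b π x₀ t (Fin.init r))).1 a)
          ((π t (posterior s b π x₀ t (Fin.init r))).2.1 a) := by
      intro a
      refine Continuous.subtype_mk (Continuous.inv₀ (Real.continuous_sqrt.comp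
        ((((hσ a).pow 2).inv₀ fun r => ?_).add (continuous_const.mul (hpa a)))) fun r => ?_) _
      · exact (pow_pos (Subtype.prop _) 2).ne'
      · exact (inv_pos.1 (nextSd (s a) (b t) ((posterior s b π x₀ t (Fin.init r)).2 a)
          ((π t (posterior s b π x₀ t (Fin.init r))).1 a)
          ((π t (posterior s b π x₀ t (Fin.init r))).2.1 a)).2).ne'
    refine Continuous.prodMk (continuous_pi fun a => ?_) (continuous_pi hnext)
    refine ((continuous_subtype_val.comp (hnext a)).pow 2).mul
      (((((hσ a).pow 2).inv₀ fun r => ?_).mul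
        ((continuous_apply a).comp (continuous_fst.comp hx))).add
        (continuous_const.mul ((continuous_apply a).comp (continuous_apply (Fin.last t)))))
    exact (pow_pos (Subtype.prop _) 2).ne'

/-! ### Transition kernels -/

/-- The product kernel `x ↦ ⨂ᵢ κᵢ(x)` of finitely many Markov kernels: given `x`, the coordinates
are independent and the `i`-th one has law `κᵢ(x)`. -/
def piKernel {α ι : Type*} [MeasurableSpace α] [Fintype ι] {β : ι → Type*}
    [∀ i, MeasurableSpace (β i)] (κ : (i : ι) → Kernel α (β i)) [∀ i, IsMarkovKernel (κ i)] :
    Kernel α ((i : ι) → β i) where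
  toFun x := Measure.pi fun i => κ i x
  measurable' := by
    refine Measurable.measure_of_isPiSystem_of_isProbabilityMeasure
      generateFrom_pi.symm isPiSystem_pi ?_
    rintro _ ⟨S, hS, rfl⟩
    simp only [Measure.pi_pi]
    exact Finset.measurable_prod _ fun i _ => (κ i).measurable_coe (hS i (Set.mem_univ i))

instance {α ι : Type*} [MeasurableSpace α] [Fintype ι] {β : ι → Type*}
    [∀ i, MeasurableSpace (β i)] (κ : (i : ι) → Kernel α (β i)) [∀ i, IsMarkovKernel (κ i)] :
    IsMarkovKernel (piKernel κ) :=
  ⟨fun x => inferInstanceAs (IsProbabilityMeasure (Measure.pi fun i => κ i x))⟩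

/-- The law on the arms in which arm `a` has probability `p a`. -/
def armLaw (p : stdSimplex ℝ (Fin K)) : Measure (Fin K) :=
  ∑ a, ENNReal.ofReal (p.1 a) • Measure.dirac a

instance (p : stdSimplex ℝ (Fin K)) : IsProbabilityMeasure (armLaw p) where
  measure_univ := by
    simp only [armLaw, Measure.coe_finsetSum, Finset.sum_apply, Measure.smul_apply, measure_univ,
      smul_eq_mul, mul_one]
    rw [← ENNReal.ofReal_sum_of_nonneg fun a _ => p.2.1 a, p.2.2, ENNReal.ofReal_one]

theorem measurable_armLaw : Measurable (armLaw (K := K)) := by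
  refine Measure.measurable_of_measurable_coe _ fun S hS => ?_
  simp only [armLaw, Measure.coe_finsetSum, Finset.sum_apply, Measure.smul_apply, smul_eq_mul]
  exact Finset.measurable_sum _ fun a _ => (ENNReal.measurable_ofReal.comp
    ((measurable_pi_apply a).comp measurable_subtype_coe)).mul_const _

/-- The allocation of epoch `t` as a function of the observations made before epoch `t`. -/
def allocation (s : Fin K → PosReal) (b : ℕ → PosReal) (π : ContinuousPolicy K) (x₀ : State K)
    (t : ℕ) (r : Fin t → Fin K → ℝ) : stdSimplex ℝ (Fin K) :=
  π t (posterior s b π x₀ t r)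

theorem measurable_allocation (s : Fin K → PosReal) (b : ℕ → PosReal) (π : ContinuousPolicy K)
    (x₀ : State K) (t : ℕ) : Measurable (allocation s b π x₀ t) :=
  ((π t).continuous.comp (continuous_posterior s b π x₀ t)).measurable

/-- Law of the arm assigned to one unit of epoch `t`, given the observations made before. -/
def armKernel (s : Fin K → PosReal) (b : ℕ → PosReal) (π : ContinuousPolicy K) (x₀ : State K)
    (t : ℕ) : Kernel (Fin t → Fin K → ℝ) (Fin K) where
  toFun r := armLaw (allocation s b π x₀ t r)
  measurable' := measurable_armLaw.comp (measurable_allocation s b π x₀ t)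

instance (s : Fin K → PosReal) (b : ℕ → PosReal) (π : ContinuousPolicy K) (x₀ : State K)
    (t : ℕ) : IsMarkovKernel (armKernel s b π x₀ t) :=
  ⟨fun r => inferInstanceAs (IsProbabilityMeasure (armLaw (allocation s b π x₀ t r)))⟩

/-- Law of the pair (assigned arm, noise vector) of one unit of epoch `t`, given the observations
made before: the arm is drawn from the allocation, independently of the noise vector, which has
law `ν`. -/
def unitKernel (s : Fin K → PosReal) (b : ℕ → PosReal) (π : ContinuousPolicy K) (x₀ : State K)
    (ν : Measure (Fin K → ℝ)) (t : ℕ) : Kernel (Fin t → Fin K → ℝ) (Fin K × (Fin K → ℝ)) :=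
  (armKernel s b π x₀ t).prod (Kernel.const _ ν)

instance (s : Fin K → PosReal) (b : ℕ → PosReal) (π : ContinuousPolicy K) (x₀ : State K)
    (ν : Measure (Fin K → ℝ)) [IsProbabilityMeasure ν] (t : ℕ) :
    IsMarkovKernel (unitKernel s b π x₀ ν t) := by
  unfold unitKernel; infer_instance

/-- The law `N(pₐ hₐ, pₐ sₐ² / b t)` with `p` the allocation of epoch `t`, given the observations
made before (a point mass if `pₐ = 0`). -/
def gaussianArmKernel (s : Fin K → PosReal) (b : ℕ → PosReal) (π : ContinuousPolicy K)
    (x₀ : State K) (h : Fin K → ℝ) (t : ℕ) (a : Fin K) : Kernel (Fin t → Fin K → ℝ) ℝ where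
  toFun r := gaussianReal ((allocation s b π x₀ t r).1 a * h a)
    ((allocation s b π x₀ t r).1 a * (s a : ℝ) ^ 2 / b t).toNNReal
  measurable' := by
    have hp : Measurable fun r => (allocation s b π x₀ t r).1 a :=
      (measurable_pi_apply a).comp (measurable_subtype_coe.comp (measurable_allocation s b π x₀ t))
    exact measurable_gaussianReal.comp
      ((hp.mul_const _).prodMk ((hp.mul_const _).div_const _).real_toNNReal)

instance (s : Fin K → PosReal) (b : ℕ → PosReal) (π : ContinuousPolicy K) (x₀ : State K)
    (h : Fin K → ℝ) (t : ℕ) (a : Fin K) : IsMarkovKernel (gaussianArmKernel s b π x₀ h t a) :=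
  ⟨fun _ => inferInstanceAs (IsProbabilityMeasure (gaussianReal _ _))⟩

/-! ### The batched experiment and its Gaussian limit -/

/-- Number of units in epoch `t` at scaling `n`: `b t * n`, rounded down. -/
def batchSize (b : ℕ → PosReal) (n t : ℕ) : ℕ := ⌊(b t : ℝ) * n⌋₊

/-- The reward of a unit at scaling `n` if it is assigned to arm `a`: `hₐ / √n + εₐ`. -/
def reward (h : Fin K → ℝ) (n : ℕ) (ε : Fin K → ℝ) (a : Fin K) : ℝ := h a / √n + ε a

/-- The scaled batch sample mean `√n R̄ₜ`, whose `a`-th entry is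
`(b t √n)⁻¹ ∑ⱼ ξₐⱼ Rₐⱼ` with `ξₐⱼ` the indicator that unit `j` is assigned to arm `a`. The batch
`y` lists the pair (assigned arm, noise vector) of each unit. -/
def scaledMean (b : ℕ → PosReal) (h : Fin K → ℝ) (n t : ℕ)
    (y : Fin (batchSize b n t) → Fin K × (Fin K → ℝ)) (a : Fin K) : ℝ :=
  1 / ((b t : ℝ) * √n) * ∑ j, (if (y j).1 = a then 1 else 0) * reward h n (y j).2 a

/-- Conditions on the law `ν` of the noise vector `ε`: mean zero, `Var εₐ = sₐ²`, and a finite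
fourth moment `𝔼 ‖ε‖₂⁴`. -/
structure IsNoiseLaw (s : Fin K → PosReal) (ν : Measure (Fin K → ℝ)) : Prop where
  mean : ∀ a, ∫ e, e a ∂ν = 0
  variance : ∀ a, Var[fun e => e a; ν] = (s a : ℝ) ^ 2
  moment : Integrable (fun e => ‖WithLp.toLp 2 e‖ ^ 4) ν

/-- `T` epochs of the batched experiment at scaling `n`, run with the policy `π` evaluated at the
pre-limit posterior states. `Y t ω j` is the pair (assigned arm, noise vector) of unit `j` of
epoch `t`. Given the aggregate observations of the epochs before `t`, the units of epoch `t` are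
independent; each is assigned to an arm drawn from the current allocation, has noise of law `ν`,
and its assignment is independent of its (potential) rewards. -/
def IsBatchedExperiment {Ω : Type*} [MeasurableSpace Ω] (s : Fin K → PosReal) (b : ℕ → PosReal)
    (π : ContinuousPolicy K) (x₀ : State K) (h : Fin K → ℝ) (ν : Measure (Fin K → ℝ))
    [IsProbabilityMeasure ν] (T n : ℕ)
    (Y : (t : ℕ) → Ω → Fin (batchSize b n t) → Fin K × (Fin K → ℝ)) (P : Measure Ω) : Prop :=
  ∀ t < T, HasCondDistrib (Y t) (fun ω (i : Fin t) => scaledMean b h n i (Y i ω))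
    (piKernel fun _ => unitKernel s b π x₀ ν t) P

/-- `G 0, …, G (T - 1)` is the Gaussian sequential experiment with average rewards `h` under the
policy `π` evaluated at the posterior states: given `G 0, …, G (t - 1)`, the vector `G t` has law
`N(p h, diag(p s² / b t))` with `p` the allocation of epoch `t`. -/
def IsGaussianExperiment {Ω : Type*} [MeasurableSpace Ω] (s : Fin K → PosReal) (b : ℕ → PosReal)
    (π : ContinuousPolicy K) (x₀ : State K) (h : Fin K → ℝ) (T : ℕ)
    (G : ℕ → Ω → Fin K → ℝ) (P : Measure Ω) : Prop :=
  ∀ t < T, HasCondDistrib (G t) (fun ω (i : Fin t) => G i ω)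
    (piKernel fun a => gaussianArmKernel s b π x₀ h t a) P

end

end BatchedExperiment

open scoped Topology

namespace BatchedExperiment

/-! ### Weak convergence of sequentially generated vectors -/

/-! Given the past, epoch `t` depends on it only through the allocation `p`, a point of the simplex.
Its `batchSize b n t` units are i.i.d., so the conditional characteristic function of the scaled
mean is `(∑ a, p a * w n a) ^ m n`, where `m n` is the batch size and `w n a` the contribution of a
unit sent to arm `a`. A second-order expansion gives `m n * (w n a - 1) → c a`, the `armCumulant`,
so the power tends to `exp (∑ a, p a * c a)`, the characteristic function of the Gaussian kernel.
The limit covariance is diagonal because mean rewards are of order `1 / √n`, so random arm counts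
add nothing to it.

The convergence is uniform in `p` (`tendstoUniformly_mixture_pow`), hence in the past. With
continuity of the limit in the past, induction on epochs passes from conditional to joint
convergence (`tendstoInDistribution_of_condCharFun`). The posterior states are a continuous function
of the observations, and the continuous mapping theorem concludes. -/

/-- Lévy's convergence theorem for families of real vectors. -/
theorem tendsto_of_tendsto_integral_cexp {ι κ : Type*} [Fintype ι] [Fintype κ]
    {μ : ℕ → ProbabilityMeasure (ι → κ → ℝ)} {μ₀ : ProbabilityMeasure (ι → κ → ℝ)}
    (hμ : ∀ u : ι → κ → ℝ, Tendsto
      (fun n => ∫ r, Complex.exp ((∑ i, ∑ a, u i a * r i a : ℝ) * Complex.I)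
        ∂(μ n : Measure (ι → κ → ℝ)))
      atTop (𝓝 (∫ r, Complex.exp ((∑ i, ∑ a, u i a * r i a : ℝ) * Complex.I)
        ∂(μ₀ : Measure (ι → κ → ℝ))))) :
    Tendsto μ atTop (𝓝 μ₀) := by
  -- Characteristic functions need an inner product, so the laws are moved to a Euclidean space by
  -- `f` and brought back by its inverse `g`; both maps are continuous.
  let f : (ι → κ → ℝ) → PiLp 2 fun _ : ι => EuclideanSpace ℝ κ :=
    fun r => WithLp.toLp 2 fun i => WithLp.toLp 2 (r i)
  let g : (PiLp 2 fun _ : ι => EuclideanSpace ℝ κ) → ι → κ → ℝ := fun x i a => x i a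
  have hf : Continuous f := by fun_prop
  have hg : Continuous g := by fun_prop
  have hchar (ρ : ProbabilityMeasure (ι → κ → ℝ)) (x : PiLp 2 fun _ : ι => EuclideanSpace ℝ κ) :
      charFun ((ρ.map hf.aemeasurable : ProbabilityMeasure _) : Measure _) x =
        ∫ r, Complex.exp ((∑ i, ∑ a, g x i a * r i a : ℝ) * Complex.I)
          ∂(ρ : Measure (ι → κ → ℝ)) := by
    rw [charFun_apply, ProbabilityMeasure.toMeasure_map, integral_map hf.aemeasurable]
    · simp [f, g, PiLp.inner_apply]
    · exact Continuous.aestronglyMeasurable (by fun_prop)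
  have hback (ρ : ProbabilityMeasure (ι → κ → ℝ)) :
      (ρ.map hf.aemeasurable).map hg.aemeasurable = ρ := by
    refine Subtype.ext ?_
    change ((ρ.map hf.aemeasurable).map hg.aemeasurable : Measure (ι → κ → ℝ)) = ρ
    rw [ProbabilityMeasure.toMeasure_map, ProbabilityMeasure.toMeasure_map,
      Measure.map_map hg.measurable hf.measurable]
    exact Measure.map_id
  have hlim : Tendsto (fun n => (μ n).map hf.aemeasurable) atTop (𝓝 (μ₀.map hf.aemeasurable)) :=
    ProbabilityMeasure.tendsto_of_tendsto_charFun fun x => by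
      simp only [hchar]
      exact hμ _
  simpa only [hback] using
    ProbabilityMeasure.tendsto_map_of_tendsto_of_continuous _ _ hlim hg

/-- Tower property: conditionally on the past `X`, the factor carrying `X` is constant and only the
conditional characteristic function of `Y` remains. -/
theorem integral_cexp_snoc {Ω κ : Type*} [MeasurableSpace Ω] [Fintype κ] {P : Measure Ω}
    [IsProbabilityMeasure P] {t : ℕ} {X : Ω → Fin t → κ → ℝ} {Y : Ω → κ → ℝ}
    {η : Kernel (Fin t → κ → ℝ) (κ → ℝ)} [IsMarkovKernel η] (h : HasCondDistrib Y X η P)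
    (u : Fin (t + 1) → κ → ℝ) :
    ∫ ω, Complex.exp ((((∑ i : Fin t, ∑ a, u i.castSucc a * X ω i a) +
        ∑ a, u (Fin.last t) a * Y ω a : ℝ)) * Complex.I) ∂P =
      ∫ r, Complex.exp ((∑ i : Fin t, ∑ a, u i.castSucc a * r i a : ℝ) * Complex.I) *
        ∫ y, Complex.exp ((∑ a, u (Fin.last t) a * y a : ℝ) * Complex.I) ∂(η r) ∂(P.map X) := by
  have hX := h.aemeasurable_fst
  have : IsProbabilityMeasure (P.map X) := Measure.isProbabilityMeasure_map hX
  let F : (Fin t → κ → ℝ) × (κ → ℝ) → ℂ := fun z =>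
    Complex.exp ((((∑ i : Fin t, ∑ a, u i.castSucc a * z.1 i a) +
        ∑ a, u (Fin.last t) a * z.2 a : ℝ)) * Complex.I)
  have hF : Continuous F := by fun_prop
  calc _ = ∫ z, F z ∂(P.map fun ω => (X ω, Y ω)) :=
        (integral_map h.aemeasurable hF.aestronglyMeasurable).symm
    _ = ∫ z, F z ∂(P.map X ⊗ₘ η) := by rw [h.map_eq]
    _ = ∫ r, ∫ y, F (r, y) ∂(η r) ∂(P.map X) := by
        refine Measure.integral_compProd (Integrable.of_bound hF.aestronglyMeasurable 1 ?_)
        exact ae_of_all _ fun z => (Complex.norm_exp_ofReal_mul_I _).le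
    _ = _ := by
        refine integral_congr_ae (ae_of_all _ fun r => ?_)
        simp only [F, Complex.ofReal_add, add_mul, Complex.exp_add, integral_const_mul]

/-- If the conditional characteristic functions converge uniformly in the past to a limit which
is continuous in the past, then the sequentially generated vectors converge in distribution. -/
theorem tendstoInDistribution_of_condCharFun {κ : Type*} [Fintype κ] {T : ℕ}
    {Ω : ℕ → Type*} [∀ n, MeasurableSpace (Ω n)] {P : (n : ℕ) → Measure (Ω n)}
    [∀ n, IsProbabilityMeasure (P n)] {Ω' : Type*} [MeasurableSpace Ω'] {P' : Measure Ω'}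
    [IsProbabilityMeasure P'] {X : (n : ℕ) → ℕ → Ω n → κ → ℝ} {G : ℕ → Ω' → κ → ℝ}
    {η : ℕ → (t : ℕ) → Kernel (Fin t → κ → ℝ) (κ → ℝ)} [∀ n t, IsMarkovKernel (η n t)]
    {η₀ : (t : ℕ) → Kernel (Fin t → κ → ℝ) (κ → ℝ)} [∀ t, IsMarkovKernel (η₀ t)]
    (hX : ∀ n, ∀ t < T, HasCondDistrib (X n t) (fun ω (i : Fin t) => X n i ω) (η n t) (P n))
    (hG : ∀ t < T, HasCondDistrib (G t) (fun ω (i : Fin t) => G i ω) (η₀ t) P')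
    (hη : ∀ t < T, ∀ v : κ → ℝ, TendstoUniformly
      (fun n r => ∫ y, Complex.exp ((∑ a, v a * y a : ℝ) * Complex.I) ∂(η n t r))
      (fun r => ∫ y, Complex.exp ((∑ a, v a * y a : ℝ) * Complex.I) ∂(η₀ t r)) atTop)
    (hη₀ : ∀ t < T, ∀ v : κ → ℝ, Continuous
      fun r => ∫ y, Complex.exp ((∑ a, v a * y a : ℝ) * Complex.I) ∂(η₀ t r)) :
    ∀ t ≤ T, TendstoInDistribution (fun n ω (i : Fin t) => X n i ω) atTop
      (fun ω (i : Fin t) => G i ω) P P' := by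
  intro t
  induction t with
  | zero =>
    intro _
    have hXm (n : ℕ) : AEMeasurable (fun ω (i : Fin 0) => X n i ω) (P n) :=
      (measurable_of_subsingleton_codomain _).aemeasurable
    have hGm : AEMeasurable (fun ω (i : Fin 0) => G i ω) P' :=
      (measurable_of_subsingleton_codomain _).aemeasurable
    have hXp (n : ℕ) := Measure.isProbabilityMeasure_map (hXm n)
    have hGp := Measure.isProbabilityMeasure_map hGm
    exact ⟨hXm, hGm, tendsto_of_tendsto_integral_cexp fun u => by simp⟩
  | succ t ih =>
    intro ht
    have hXm (n : ℕ) : AEMeasurable (fun ω (i : Fin (t + 1)) => X n i ω) (P n) :=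
      aemeasurable_pi_lambda _ fun i => (hX n i (by omega)).aemeasurable_snd
    have hGm : AEMeasurable (fun ω (i : Fin (t + 1)) => G i ω) P' :=
      aemeasurable_pi_lambda _ fun i => (hG i (by omega)).aemeasurable_snd
    have ih' := ih (by omega)
    refine ⟨hXm, hGm, tendsto_of_tendsto_integral_cexp fun u => ?_⟩
    let c : (Fin t → κ → ℝ) → ℂ := fun r =>
      Complex.exp ((∑ i : Fin t, ∑ a, u i.castSucc a * r i a : ℝ) * Complex.I)
    have hc : Continuous c := by fun_prop
    have hc1 (r) : ‖c r‖ = 1 := Complex.norm_exp_ofReal_mul_I _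
    let φ : ℕ → (Fin t → κ → ℝ) → ℂ := fun n r =>
      ∫ y, Complex.exp ((∑ a, u (Fin.last t) a * y a : ℝ) * Complex.I) ∂(η n t r)
    let φ₀ : (Fin t → κ → ℝ) → ℂ := fun r =>
      ∫ y, Complex.exp ((∑ a, u (Fin.last t) a * y a : ℝ) * Complex.I) ∂(η₀ t r)
    have hφm (n : ℕ) : StronglyMeasurable (φ n) :=
      StronglyMeasurable.integral_kernel (Continuous.stronglyMeasurable (by fun_prop))
    have hφ₀c : Continuous φ₀ := hη₀ t ht _
    have hbound (ρ : Measure (κ → ℝ)) [IsProbabilityMeasure ρ] :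
        ‖∫ y, Complex.exp ((∑ a, u (Fin.last t) a * y a : ℝ) * Complex.I) ∂ρ‖ ≤ 1 := by
      refine (norm_integral_le_of_norm_le_const (C := 1) (ae_of_all _ fun y => ?_)).trans (by simp)
      exact (Complex.norm_exp_ofReal_mul_I _).le
    have hφ1 (n r) : ‖φ n r‖ ≤ 1 := hbound _
    have hφ₀1 (r) : ‖φ₀ r‖ ≤ 1 := hbound _
    have hPX (n : ℕ) : ∫ r, Complex.exp ((∑ i, ∑ a, u i a * r i a : ℝ) * Complex.I)
        ∂((P n).map fun ω (i : Fin (t + 1)) => X n i ω) =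
          ∫ r, c r * φ n r ∂((P n).map fun ω (i : Fin t) => X n i ω) := by
      rw [integral_map (hXm n) (Continuous.aestronglyMeasurable (by fun_prop))]
      simp only [Fin.sum_univ_castSucc]
      exact integral_cexp_snoc (hX n t ht) u
    have hPG : ∫ r, Complex.exp ((∑ i, ∑ a, u i a * r i a : ℝ) * Complex.I)
        ∂(P'.map fun ω (i : Fin (t + 1)) => G i ω) =
          ∫ r, c r * φ₀ r ∂(P'.map fun ω (i : Fin t) => G i ω) := by
      rw [integral_map hGm (Continuous.aestronglyMeasurable (by fun_prop))]
      simp only [Fin.sum_univ_castSucc]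
      exact integral_cexp_snoc (hG t ht) u
    simp only [ProbabilityMeasure.coe_mk]
    rw [hPG]
    simp only [hPX]
    -- With the limit kernel in place, the integrand is one fixed bounded continuous function of the
    -- past, so the induction hypothesis applies.
    have hweak : Tendsto (fun n => ∫ r, c r * φ₀ r ∂((P n).map fun ω (i : Fin t) => X n i ω)) atTop
        (𝓝 (∫ r, c r * φ₀ r ∂(P'.map fun ω (i : Fin t) => G i ω))) :=
      (ProbabilityMeasure.tendsto_iff_forall_integral_rclike_tendsto ℂ).1 ih'.tendsto
        (BoundedContinuousFunction.ofNormedAddCommGroup (fun r => c r * φ₀ r) (hc.mul hφ₀c) 1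
          fun r => by simpa [hc1] using hφ₀1 r)
    -- Replacing `φ₀` by `φ n` costs at most the uniform distance between them, whatever the law of
    -- the past, since `c` has modulus one.
    refine hweak.congr_dist ?_
    refine Metric.tendsto_atTop.2 fun ε hε => ?_
    obtain ⟨N, hN⟩ := eventually_atTop.1
      (Metric.tendstoUniformly_iff.1 (hη t ht (u (Fin.last t))) (ε / 2) (by positivity))
    refine ⟨N, fun n hn => ?_⟩
    have : IsProbabilityMeasure ((P n).map fun ω (i : Fin t) => X n i ω) :=
      Measure.isProbabilityMeasure_map (ih'.forall_aemeasurable n)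
    have hi₀ : Integrable (fun r => c r * φ₀ r) ((P n).map fun ω (i : Fin t) => X n i ω) :=
      Integrable.of_bound (hc.mul hφ₀c).aestronglyMeasurable 1
        (ae_of_all _ fun r => by simpa [hc1] using hφ₀1 r)
    have hi : Integrable (fun r => c r * φ n r) ((P n).map fun ω (i : Fin t) => X n i ω) :=
      Integrable.of_bound (hc.aestronglyMeasurable.mul (hφm n).aestronglyMeasurable) 1
        (ae_of_all _ fun r => by simpa [hc1] using hφ1 n r)
    rw [Real.dist_0_eq_abs, abs_of_nonneg dist_nonneg, dist_eq_norm, ← integral_sub hi₀ hi]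
    refine lt_of_le_of_lt (norm_integral_le_of_norm_le_const (C := ε / 2)
      (ae_of_all _ fun r => ?_)) (by simpa using hε)
    rw [← mul_sub, norm_mul, hc1, one_mul, ← dist_eq_norm]
    exact (hN n hn r).le

/-! ### A uniform exponential limit -/

theorem norm_pow_sub_pow_le_mul {z w : ℂ} (hz : ‖z‖ ≤ 1) (hw : ‖w‖ ≤ 1) (m : ℕ) :
    ‖z ^ m - w ^ m‖ ≤ m * ‖z - w‖ := by
  induction m with
  | zero => simp
  | succ m ih =>
    have h : z ^ (m + 1) - w ^ (m + 1) = z ^ m * (z - w) + (z ^ m - w ^ m) * w := by ring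
    have h1 : ‖z‖ ^ m ≤ 1 := pow_le_one₀ (norm_nonneg _) hz
    calc ‖z ^ (m + 1) - w ^ (m + 1)‖ ≤ ‖z‖ ^ m * ‖z - w‖ + ‖z ^ m - w ^ m‖ * ‖w‖ := by
          rw [h]
          refine (norm_add_le _ _).trans ?_
          rw [norm_mul, norm_mul, norm_pow]
      _ ≤ 1 * ‖z - w‖ + m * ‖z - w‖ * 1 := by gcongr
      _ = (m + 1 : ℕ) * ‖z - w‖ := by push_cast; ring

/-- Both `w` and `exp (c / m)` lie in the unit disc, so their `m`-th powers differ by at most `m`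
times their distance. The bound `‖c‖ ≤ m` gives the exponential a quadratic remainder `(‖c‖ / m) ^
2`, which contributes `‖c‖ ^ 2 / m` in total. -/
theorem norm_pow_sub_exp_le {w c : ℂ} {m : ℕ} (hm : 0 < m) (hw : ‖w‖ ≤ 1) (hc : c.re ≤ 0)
    (hcm : ‖c‖ ≤ m) : ‖w ^ m - Complex.exp c‖ ≤ ‖m * (w - 1) - c‖ + ‖c‖ ^ 2 / m := by
  have hm' : (0 : ℝ) < m := by exact_mod_cast hm
  have hmc : (m : ℂ) ≠ 0 := by exact_mod_cast hm.ne'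
  have hexp : Complex.exp c = Complex.exp (c / m) ^ m := by
    rw [← Complex.exp_nat_mul]
    field_simp
  have hnorm : ‖c / m‖ = ‖c‖ / m := by simp
  have h1 : ‖Complex.exp (c / m)‖ ≤ 1 := by
    rw [Complex.norm_exp, Complex.div_natCast_re]
    exact Real.exp_le_one_iff.2 (div_nonpos_of_nonpos_of_nonneg hc hm'.le)
  have h2 : ‖Complex.exp (c / m) - 1 - c / m‖ ≤ (‖c‖ / m) ^ 2 := by
    rw [← hnorm]
    refine Complex.norm_exp_sub_one_sub_id_le ?_
    rw [hnorm]
    exact (div_le_one hm').2 hcm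
  have h3 : w - Complex.exp (c / m) =
      (w - 1 - c / m) - (Complex.exp (c / m) - 1 - c / m) := by ring
  have h4 : (m : ℂ) * (w - 1) - c = m * (w - 1 - c / m) := by field_simp
  calc ‖w ^ m - Complex.exp c‖ ≤ m * ‖w - Complex.exp (c / m)‖ := by
        rw [hexp]
        exact norm_pow_sub_pow_le_mul hw h1 m
    _ ≤ m * (‖w - 1 - c / m‖ + (‖c‖ / m) ^ 2) := by
        rw [h3]
        gcongr
        exact (norm_sub_le _ _).trans (by gcongr)
    _ = ‖m * (w - 1) - c‖ + ‖c‖ ^ 2 / m := by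
        rw [h4, norm_mul, Complex.norm_natCast]
        field_simp

/-- The bound is free of `p`; this is the source of uniformity over allocations. -/
theorem norm_sum_stdSimplex_mul_le {κ : Type*} [Fintype κ] (p : stdSimplex ℝ κ) (z : κ → ℂ) :
    ‖∑ a, (p.1 a : ℂ) * z a‖ ≤ ∑ a, ‖z a‖ := by
  refine norm_sum_le_of_le _ fun a _ => ?_
  rw [norm_mul, Complex.norm_real, Real.norm_of_nonneg (p.2.1 a)]
  exact mul_le_of_le_one_left (norm_nonneg _) (stdSimplex.le_one p a)

/-- Powers of mixtures of near-identity contractions converge to the exponential, uniformly in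
the mixing weights. -/
theorem tendstoUniformly_mixture_pow {κ : Type*} [Fintype κ] {m : ℕ → ℕ}
    (hm : Tendsto m atTop atTop) {w : ℕ → κ → ℂ} {c : κ → ℂ} (hw : ∀ n a, ‖w n a‖ ≤ 1)
    (hc : ∀ a, (c a).re ≤ 0)
    (hwc : ∀ a, Tendsto (fun n => (m n : ℂ) * (w n a - 1)) atTop (𝓝 (c a))) :
    TendstoUniformly (fun n (p : stdSimplex ℝ κ) => (∑ a, (p.1 a : ℂ) * w n a) ^ m n)
      (fun p => Complex.exp (∑ a, (p.1 a : ℂ) * c a)) atTop := by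
  have hm' : Tendsto (fun n => (m n : ℝ)) atTop atTop := tendsto_natCast_atTop_atTop.comp hm
  set C : ℝ := ∑ a, ‖c a‖
  have hlim : Tendsto (fun n => ∑ a, ‖(m n : ℂ) * (w n a - 1) - c a‖ + C ^ 2 / m n) atTop (𝓝 0) := by
    have h1 : Tendsto (fun n => ∑ a, ‖(m n : ℂ) * (w n a - 1) - c a‖) atTop (𝓝 (∑ _a : κ, 0)) :=
      tendsto_finsetSum _ fun a _ => tendsto_iff_norm_sub_tendsto_zero.1 (hwc a)
    simpa using h1.add (hm'.const_div_atTop (C ^ 2))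
  refine Metric.tendstoUniformly_iff.2 fun ε hε => ?_
  filter_upwards [hlim.eventually (gt_mem_nhds hε), hm.eventually_gt_atTop 0,
    hm'.eventually_ge_atTop C] with n hn hn0 hnC p
  have hp1 : (∑ a, (p.1 a : ℂ)) = 1 := by exact_mod_cast p.2.2
  have hpw : ‖∑ a, (p.1 a : ℂ) * w n a‖ ≤ 1 := by
    calc ‖∑ a, (p.1 a : ℂ) * w n a‖ ≤ ∑ a, p.1 a := by
          refine norm_sum_le_of_le _ fun a _ => ?_
          rw [norm_mul, Complex.norm_real, Real.norm_of_nonneg (p.2.1 a)]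
          exact mul_le_of_le_one_right (p.2.1 a) (hw n a)
      _ = 1 := p.2.2
  have hpc : (∑ a, (p.1 a : ℂ) * c a).re ≤ 0 := by
    rw [Complex.re_sum]
    refine Finset.sum_nonpos fun a _ => ?_
    rw [Complex.re_ofReal_mul]
    exact mul_nonpos_of_nonneg_of_nonpos (p.2.1 a) (hc a)
  have hpC : ‖∑ a, (p.1 a : ℂ) * c a‖ ≤ C := norm_sum_stdSimplex_mul_le p c
  -- Since the weights sum to one, the linearised error of the mixture is the mixture of the errors
  -- of the arms.
  have hlin : (m n : ℂ) * (∑ a, (p.1 a : ℂ) * w n a - 1) - ∑ a, (p.1 a : ℂ) * c a =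
      ∑ a, (p.1 a : ℂ) * ((m n : ℂ) * (w n a - 1) - c a) := by
    nth_rewrite 1 [← hp1]
    rw [← Finset.sum_sub_distrib, Finset.mul_sum, ← Finset.sum_sub_distrib]
    exact Finset.sum_congr rfl fun a _ => by ring
  rw [dist_comm, dist_eq_norm]
  refine lt_of_le_of_lt ((norm_pow_sub_exp_le hn0 hpw hpc (hpC.trans hnC)).trans ?_) hn
  rw [hlin]
  have := norm_sum_stdSimplex_mul_le p fun a => (m n : ℂ) * (w n a - 1) - c a
  gcongr

/-! ### Second-order expansion of the characteristic function of one reward -/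

/-- Taylor expansion `1 - s ^ 2 * y ^ 2 / 2 + o(y ^ 2)` at `y = x / √n`. -/
theorem tendsto_mul_charFun_sub_one {Ω : Type*} [MeasurableSpace Ω] {P : Measure Ω}
    [IsProbabilityMeasure P] {X : Ω → ℝ} (hX : AEMeasurable X P) {s : ℝ} (hs : s ≠ 0)
    (h0 : P[X] = 0) (h1 : Var[X; P] = s ^ 2) (x : ℝ) :
    Tendsto (fun n : ℕ => (n : ℂ) * (charFun (P.map X) (x / √n) - 1)) atTop
      (𝓝 (-(s ^ 2 * x ^ 2 / 2 : ℝ))) := by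
  -- `taylor_charFun_two` is for unit variance, hence the rescaling by `s⁻¹`.
  have hX' : AEMeasurable (fun ω => s⁻¹ * X ω) P := hX.const_mul _
  have h0' : P[fun ω => s⁻¹ * X ω] = 0 := by rw [integral_const_mul, h0, mul_zero]
  have h1' : P[(fun ω => s⁻¹ * X ω) ^ 2] = 1 := by
    simp only [Pi.pow_apply]
    rw [← variance_of_integral_eq_zero hX' h0', variance_const_mul, h1]
    field_simp
  have hscale (y : ℝ) : charFun (P.map fun ω => s⁻¹ * X ω) (s * y) = charFun (P.map X) y := by
    rw [charFun_map_mul_comp hX, inv_mul_cancel_left₀ hs]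
  have hzero : Tendsto (fun n : ℕ => s * (x / √n)) atTop (𝓝 0) := by
    rw [← mul_zero s]
    exact ((Real.tendsto_sqrt_atTop.comp tendsto_natCast_atTop_atTop).const_div_atTop x).const_mul s
  have hlittle := ((taylor_charFun_two hX' h0' h1').comp_tendsto hzero)
  have hO : (fun n : ℕ => charFun (P.map X) (x / √n) - (1 - (s ^ 2 * x ^ 2 / 2 : ℝ) / n))
      =o[atTop] fun n : ℕ => ((n : ℂ))⁻¹ := by
    rw [← Asymptotics.isLittleO_norm_right]
    -- Dropping the constant from the right-hand side is valid even when it vanishes, so `x = 0`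
    -- needs no separate case.
    refine Asymptotics.IsLittleO.of_const_mul_right (c := s ^ 2 * x ^ 2) ?_
    refine (hlittle.congr (fun n => ?_) fun n => ?_)
    · simp only [Function.comp_apply, hscale]
      have : ((s * (x / √n)) ^ 2 : ℝ) = s ^ 2 * x ^ 2 / n := by
        rw [mul_pow, div_pow, Real.sq_sqrt (Nat.cast_nonneg n)]; ring
      rw [← Complex.ofReal_pow, this]
      push_cast
      ring
    · simp only [Function.comp_apply]
      rw [mul_pow, div_pow, Real.sq_sqrt (Nat.cast_nonneg n), norm_inv, Complex.norm_natCast]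
      ring
  have hlim := hO.tendsto_div_nhds_zero.sub_const ((s ^ 2 * x ^ 2 / 2 : ℝ) : ℂ)
  rw [zero_sub] at hlim
  push_cast at hlim ⊢
  refine hlim.congr' ?_
  filter_upwards [eventually_gt_atTop 0] with n hn
  have : (n : ℂ) ≠ 0 := by exact_mod_cast hn.ne'
  field_simp
  ring

/-- The derivative at `0` of `x ↦ exp (i y x)`, taken along the increments `1 / n`. -/
theorem tendsto_mul_exp_div_sub_one (y : ℝ) :
    Tendsto (fun n : ℕ => (n : ℂ) * (Complex.exp ((y / n : ℝ) * Complex.I) - 1)) atTop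
      (𝓝 (y * Complex.I)) := by
  have hd : HasDerivAt (fun x : ℝ => Complex.exp ((y * x : ℝ) * Complex.I)) (y * Complex.I) 0 := by
    have h1 : HasDerivAt (fun x : ℝ => ((y * x : ℝ) : ℂ) * Complex.I) (y * Complex.I) 0 := by
      have := ((hasDerivAt_id (0 : ℝ)).const_mul y).ofReal_comp.mul_const Complex.I
      simpa using this
    simpa using h1.cexp
  have hlim := hd.tendsto_slope_zero_right.comp
    (tendsto_inv_atTop_nhdsGT_zero.comp (tendsto_natCast_atTop_atTop (R := ℝ)))
  refine hlim.congr fun n => ?_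
  simp [div_eq_mul_inv]

/-! ### Characteristic functions of the batch means -/

theorem integral_armLaw {K : ℕ} (p : stdSimplex ℝ (Fin K)) (f : Fin K → ℂ) :
    ∫ a, f a ∂(armLaw p) = ∑ a, (p.1 a : ℂ) * f a := by
  rw [armLaw, integral_finsetSum_measure fun a _ =>
    (Integrable.of_finite (μ := Measure.dirac a)).smul_measure ENNReal.ofReal_ne_top]
  refine Finset.sum_congr rfl fun a _ => ?_
  rw [integral_smul_measure, integral_dirac, ENNReal.toReal_ofReal (p.2.1 a), Complex.real_smul]

theorem measurable_scaledMean {K : ℕ} (b : ℕ → PosReal) (h : Fin K → ℝ) (n t : ℕ) :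
    Measurable (scaledMean b h n t) := by
  refine measurable_pi_lambda _ fun a => Measurable.const_mul ?_ _
  refine Finset.measurable_sum _ fun j _ => Measurable.mul ?_ ?_
  · exact (measurable_of_finite fun a' : Fin K => if a' = a then (1 : ℝ) else 0).comp
      (measurable_fst.comp (measurable_pi_apply j))
  · exact measurable_const.add
      ((measurable_pi_apply a).comp (measurable_snd.comp (measurable_pi_apply j)))

/-- Each unit has exactly one arm, so exchanging the sums leaves one term per unit; the exponential
then factors over units. -/
theorem sum_mul_scaledMean {K : ℕ} (b : ℕ → PosReal) (h : Fin K → ℝ) (n t : ℕ)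
    (v : Fin K → ℝ) (y : Fin (batchSize b n t) → Fin K × (Fin K → ℝ)) :
    ∑ a, v a * scaledMean b h n t y a =
      ∑ j, v (y j).1 / ((b t : ℝ) * √n) * reward h n (y j).2 (y j).1 := by
  simp only [scaledMean, Finset.mul_sum]
  rw [Finset.sum_comm]
  refine Finset.sum_congr rfl fun j _ => ?_
  rw [Finset.sum_eq_single (y j).1 (fun a _ ha => by simp [ha.symm]) (by simp)]
  simp only [if_true]
  ring

/-- The characteristic function of the contribution of one unit assigned to arm `a`. -/
noncomputable def unitCharFun {K : ℕ} (b : ℕ → PosReal) (h : Fin K → ℝ) (ν : Measure (Fin K → ℝ))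
    (v : Fin K → ℝ) (t n : ℕ) (a : Fin K) : ℂ :=
  ∫ e, Complex.exp ((v a / ((b t : ℝ) * √n) * reward h n e a : ℝ) * Complex.I) ∂ν

/-- The power comes from the units being conditionally i.i.d., the mixture from the assignment being
independent of the noise. -/
theorem integral_scaledMean_kernel {K : ℕ} (s : Fin K → PosReal) (b : ℕ → PosReal)
    (π : ContinuousPolicy K) (x₀ : State K) (h : Fin K → ℝ) (ν : Measure (Fin K → ℝ))
    [IsProbabilityMeasure ν] (v : Fin K → ℝ) (n t : ℕ) (r : Fin t → Fin K → ℝ) :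
    ∫ y, Complex.exp ((∑ a, v a * y a : ℝ) * Complex.I)
      ∂(((piKernel fun _ => unitKernel s b π x₀ ν t).map (scaledMean b h n t)) r) =
    (∑ a, ((allocation s b π x₀ t r).1 a : ℂ) * unitCharFun b h ν v t n a) ^ batchSize b n t := by
  let F : Fin K × (Fin K → ℝ) → ℂ := fun z =>
    Complex.exp ((v z.1 / ((b t : ℝ) * √n) * reward h n z.2 z.1 : ℝ) * Complex.I)
  have hF : Measurable F := by
    refine measurable_from_prod_countable_right fun a => ?_
    simp only [F, reward]
    exact Continuous.measurable (by fun_prop)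
  rw [Kernel.map_apply _ (measurable_scaledMean b h n t),
    integral_map (measurable_scaledMean b h n t).aemeasurable
      (Continuous.aestronglyMeasurable (by fun_prop))]
  have hprod (y : Fin (batchSize b n t) → Fin K × (Fin K → ℝ)) :
      Complex.exp ((∑ a, v a * scaledMean b h n t y a : ℝ) * Complex.I) = ∏ j, F (y j) := by
    rw [sum_mul_scaledMean, Complex.ofReal_sum, Finset.sum_mul, Complex.exp_sum]
  simp only [hprod]
  change ∫ y, ∏ j, F (y j) ∂(Measure.pi fun _ => unitKernel s b π x₀ ν t r) = _
  rw [integral_fintype_prod_eq_pow F, Fintype.card_fin]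
  congr 1
  rw [unitKernel, Kernel.prod_apply, Kernel.const_apply, integral_prod]
  · exact integral_armLaw _ _
  · exact Integrable.of_bound hF.aestronglyMeasurable 1
      (ae_of_all _ fun z => (Complex.norm_exp_ofReal_mul_I _).le)

theorem norm_unitCharFun_le_one {K : ℕ} (b : ℕ → PosReal) (h : Fin K → ℝ)
    (ν : Measure (Fin K → ℝ)) [IsProbabilityMeasure ν] (v : Fin K → ℝ) (t n : ℕ) (a : Fin K) :
    ‖unitCharFun b h ν v t n a‖ ≤ 1 := by
  refine (norm_integral_le_of_norm_le_const (C := 1) (ae_of_all _ fun y => ?_)).trans (by simp)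
  exact (Complex.norm_exp_ofReal_mul_I _).le

/-- The mean reward gives a deterministic phase of order `1 / n`; the noise enters at scale `1 /
√n`. Both therefore matter at the same order after multiplication by the batch size. -/
theorem unitCharFun_eq {K : ℕ} (b : ℕ → PosReal) (h : Fin K → ℝ) (ν : Measure (Fin K → ℝ))
    (v : Fin K → ℝ) (t n : ℕ) (a : Fin K) :
    unitCharFun b h ν v t n a = Complex.exp ((v a * h a / b t / n : ℝ) * Complex.I) *
      charFun (ν.map fun e => e a) (v a / b t / √n) := by
  rw [charFun_apply_real, integral_map (measurable_pi_apply a).aemeasurable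
    (Continuous.aestronglyMeasurable (by fun_prop)),
    ← integral_const_mul, unitCharFun]
  refine integral_congr_ae (ae_of_all _ fun e => ?_)
  simp only [reward]
  rw [← Complex.exp_add]
  congr 1
  have hn : v a / ((b t : ℝ) * √n) * (h a / √n + e a) =
      v a * h a / b t / n + v a / b t / √n * e a := by
    rw [mul_add, div_mul_div_comm, mul_assoc (b t : ℝ), Real.mul_self_sqrt (Nat.cast_nonneg n)]
    simp only [div_div]
  rw [hn]
  push_cast
  ring

theorem tendsto_batchSize_div (b : ℕ → PosReal) (t : ℕ) :
    Tendsto (fun n : ℕ => (batchSize b n t : ℝ) / n) atTop (𝓝 (b t)) :=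
  (tendsto_nat_floor_mul_div_atTop (b t).2.le).comp tendsto_natCast_atTop_atTop

theorem tendsto_batchSize (b : ℕ → PosReal) (t : ℕ) :
    Tendsto (fun n => batchSize b n t) atTop atTop :=
  tendsto_nat_floor_atTop.comp (tendsto_natCast_atTop_atTop.const_mul_atTop (b t).2)

/-- The cumulant of the Gaussian limit, per unit of allocation to arm `a`. -/
noncomputable def armCumulant {K : ℕ} (s : Fin K → PosReal) (b : ℕ → PosReal) (h : Fin K → ℝ)
    (v : Fin K → ℝ) (t : ℕ) (a : Fin K) : ℂ :=
  (v a * h a : ℝ) * Complex.I - ((s a : ℝ) ^ 2 * v a ^ 2 / (2 * b t) : ℝ)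

theorem armCumulant_re_nonpos {K : ℕ} (s : Fin K → PosReal) (b : ℕ → PosReal) (h : Fin K → ℝ)
    (v : Fin K → ℝ) (t : ℕ) (a : Fin K) : (armCumulant s b h v t a).re ≤ 0 := by
  have := (b t).2
  simp only [armCumulant, Complex.sub_re, Complex.re_ofReal_mul, Complex.I_re, mul_zero,
    Complex.ofReal_re, zero_sub, neg_nonpos]
  positivity

/-- With phase `φ`, noise factor `χ` and batch size `m`, write `m (φ χ - 1) = (m / n) (n (φ - 1) χ +
n (χ - 1))`. Here `m / n → b t` and `χ → 1`, and the two expansions above give the rest. -/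
theorem tendsto_batchSize_mul_unitCharFun {K : ℕ} {s : Fin K → PosReal} (b : ℕ → PosReal)
    (h : Fin K → ℝ) {ν : Measure (Fin K → ℝ)} [IsProbabilityMeasure ν] (hν : IsNoiseLaw s ν)
    (v : Fin K → ℝ) (t : ℕ) (a : Fin K) :
    Tendsto (fun n => (batchSize b n t : ℂ) * (unitCharFun b h ν v t n a - 1)) atTop
      (𝓝 (armCumulant s b h v t a)) := by
  have hb := (b t).2
  have hX : AEMeasurable (fun e : Fin K → ℝ => e a) ν :=
    (measurable_pi_apply a).aemeasurable
  have : IsProbabilityMeasure (ν.map fun e => e a) := Measure.isProbabilityMeasure_map hX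
  have hχ := tendsto_mul_charFun_sub_one hX (s a).2.ne' (hν.mean a) (hν.variance a) (v a / b t)
  have hχ1 : Tendsto (fun n : ℕ => charFun (ν.map fun e => e a) (v a / b t / √n)) atTop (𝓝 1) := by
    have h0 : Tendsto (fun n : ℕ => v a / b t / √n) atTop (𝓝 0) :=
      (Real.tendsto_sqrt_atTop.comp tendsto_natCast_atTop_atTop).const_div_atTop _
    have hc := (continuous_charFun (μ := ν.map fun e => e a)).tendsto 0
    rw [charFun_zero] at hc
    simpa [Function.comp_def] using hc.comp h0
  have hmain := (((tendsto_mul_exp_div_sub_one (v a * h a / b t)).mul hχ1).add hχ)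
  have hm : Tendsto (fun n : ℕ => (((batchSize b n t : ℝ) / n : ℝ) : ℂ)) atTop (𝓝 ((b t : ℝ) : ℂ)) :=
    (Complex.continuous_ofReal.tendsto _).comp (tendsto_batchSize_div b t)
  have hfinal := hm.mul hmain
  have hlim : ((b t : ℝ) : ℂ) * (((v a * h a / b t : ℝ) : ℂ) * Complex.I * 1 +
      -((s a : ℝ) ^ 2 * (v a / b t) ^ 2 / 2 : ℝ)) = armCumulant s b h v t a := by
    have : ((b t : ℝ) : ℂ) ≠ 0 := by exact_mod_cast hb.ne'
    rw [armCumulant]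
    push_cast
    field_simp
    ring
  rw [← hlim]
  refine hfinal.congr' ?_
  filter_upwards [eventually_gt_atTop 0] with n hn
  have : (n : ℂ) ≠ 0 := by exact_mod_cast hn.ne'
  rw [unitCharFun_eq]
  push_cast
  field_simp
  ring

/-- Mean and variance of each arm are both linear in its allocation, so the exponent is linear in
`p`, as the limit of the mixtures requires. -/
theorem integral_gaussianArm_kernel {K : ℕ} (s : Fin K → PosReal) (b : ℕ → PosReal)
    (π : ContinuousPolicy K) (x₀ : State K) (h v : Fin K → ℝ) (t : ℕ) (r : Fin t → Fin K → ℝ) :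
    ∫ y, Complex.exp ((∑ a, v a * y a : ℝ) * Complex.I)
      ∂((piKernel fun a => gaussianArmKernel s b π x₀ h t a) r) =
    Complex.exp (∑ a, ((allocation s b π x₀ t r).1 a : ℂ) * armCumulant s b h v t a) := by
  have hprod (y : Fin K → ℝ) : Complex.exp ((∑ a, v a * y a : ℝ) * Complex.I) =
      ∏ a, Complex.exp (v a * y a * Complex.I) := by
    rw [Complex.ofReal_sum, Finset.sum_mul, Complex.exp_sum]
    simp
  simp only [hprod]
  change ∫ y : Fin K → ℝ, ∏ a, Complex.exp (v a * y a * Complex.I)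
    ∂(Measure.pi fun a => gaussianArmKernel s b π x₀ h t a r) = _
  rw [integral_fintype_prod_eq_prod fun a (x : ℝ) => Complex.exp (v a * x * Complex.I),
    Complex.exp_sum]
  refine Finset.prod_congr rfl fun a _ => ?_
  have hp := (allocation s b π x₀ t r).2.1 a
  have hb := (b t).2
  rw [← charFun_apply_real]
  change charFun (gaussianReal _ _) _ = _
  rw [charFun_gaussianReal, Real.coe_toNNReal _ (by positivity), armCumulant]
  congr 1
  have : ((b t : ℝ) : ℂ) ≠ 0 := by exact_mod_cast hb.ne'
  push_cast
  field_simp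

theorem continuous_allocation {K : ℕ} (s : Fin K → PosReal) (b : ℕ → PosReal)
    (π : ContinuousPolicy K) (x₀ : State K) (t : ℕ) : Continuous (allocation s b π x₀ t) :=
  (π t).continuous.comp (continuous_posterior s b π x₀ t)

/-- The vector of scaled batch means converges in distribution to the Gaussian sequential
experiment. -/
theorem tendstoInDistribution_scaledMean {K T : ℕ} {s : Fin K → PosReal} {b : ℕ → PosReal}
    {π : ContinuousPolicy K} {x₀ : State K} {h : Fin K → ℝ}
    {ν : Measure (Fin K → ℝ)} [IsProbabilityMeasure ν] (hν : IsNoiseLaw s ν)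
    {Ω : ℕ → Type*} [∀ n, MeasurableSpace (Ω n)] {P : (n : ℕ) → Measure (Ω n)}
    [∀ n, IsProbabilityMeasure (P n)]
    {Y : (n t : ℕ) → Ω n → Fin (batchSize b n t) → Fin K × (Fin K → ℝ)}
    (hY : ∀ n, IsBatchedExperiment s b π x₀ h ν T n (Y n) (P n))
    {Ω' : Type*} [MeasurableSpace Ω'] {P' : Measure Ω'} [IsProbabilityMeasure P']
    {G : ℕ → Ω' → Fin K → ℝ} (hG : IsGaussianExperiment s b π x₀ h T G P') :
    TendstoInDistribution (fun n ω (i : Fin T) => scaledMean b h n i (Y n i ω)) atTop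
      (fun ω (i : Fin T) => G i ω) P P' := by
  have hη (n t : ℕ) : IsMarkovKernel
      ((piKernel fun _ => unitKernel s b π x₀ ν t).map (scaledMean b h n t)) :=
    Kernel.IsMarkovKernel.map _ (measurable_scaledMean b h n t)
  refine tendstoInDistribution_of_condCharFun
    (X := fun n t ω => scaledMean b h n t (Y n t ω))
    (η := fun n t => (piKernel fun _ => unitKernel s b π x₀ ν t).map (scaledMean b h n t))
    (η₀ := fun t => piKernel fun a => gaussianArmKernel s b π x₀ h t a)
    (fun n t ht => (hY n t ht).comp_left (measurable_scaledMean b h n t)) hG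
    (fun t _ v => ?_) (fun t _ v => ?_) T le_rfl
  · simp only [integral_scaledMean_kernel, integral_gaussianArm_kernel]
    -- Uniform convergence on the simplex becomes uniform convergence over pasts by composing with
    -- the allocation.
    exact (tendstoUniformly_mixture_pow (tendsto_batchSize b t)
      (norm_unitCharFun_le_one b h ν v t) (armCumulant_re_nonpos s b h v t)
      (tendsto_batchSize_mul_unitCharFun b h hν v t)).comp (allocation s b π x₀ t)
  · simp only [integral_gaussianArm_kernel]
    refine Complex.continuous_exp.comp (continuous_finsetSum _ fun a _ => Continuous.mul ?_
      continuous_const)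
    exact Complex.continuous_ofReal.comp ((continuous_apply a).comp
      (continuous_subtype_val.comp (continuous_allocation s b π x₀ t)))

end BatchedExperiment

theorem mainTheorem9 {K T : ℕ}
    (s : Fin K → BatchedExperiment.PosReal) (b : ℕ → BatchedExperiment.PosReal)
    (π : BatchedExperiment.ContinuousPolicy K) (x₀ : BatchedExperiment.State K)
    (h : Fin K → ℝ)
    (ν : Measure (Fin K → ℝ)) [IsProbabilityMeasure ν] (hν : BatchedExperiment.IsNoiseLaw s ν)
    {Ω : ℕ → Type*} [∀ n, MeasurableSpace (Ω n)] (P : (n : ℕ) → Measure (Ω n))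
    [∀ n, IsProbabilityMeasure (P n)]
    (Y : (n t : ℕ) → Ω n → Fin (BatchedExperiment.batchSize b n t) → Fin K × (Fin K → ℝ))
    (hY : ∀ n, BatchedExperiment.IsBatchedExperiment s b π x₀ h ν T n (Y n) (P n))
    {Ω' : Type*} [MeasurableSpace Ω'] (P' : Measure Ω') [IsProbabilityMeasure P']
    (G : ℕ → Ω' → Fin K → ℝ)
    (hG : BatchedExperiment.IsGaussianExperiment s b π x₀ h T G P') :
    TendstoInDistribution
      (fun n ω (t : Fin T) => BatchedExperiment.posterior s b π x₀ t
        fun i : Fin t => BatchedExperiment.scaledMean b h n i (Y n i ω))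
      atTop
      (fun ω (t : Fin T) => BatchedExperiment.posterior s b π x₀ t fun i : Fin t => G i ω)
      P P' := by
  -- All `T` states are read off one vector of observations, the state of epoch `t` from its first
  -- `t` entries, so convergence is joint over epochs.
  have hcont : Continuous fun (r : Fin T → Fin K → ℝ) (t : Fin T) =>
      BatchedExperiment.posterior s b π x₀ t fun i : Fin t => r (i.castLE t.2.le) :=
    continuous_pi fun t => (BatchedExperiment.continuous_posterior s b π x₀ t).comp
      (continuous_pi fun i => continuous_apply _)
  exact (BatchedExperiment.tendstoInDistribution_scaledMean hν hY hG).continuous_comp hcont
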